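/- For $n\ge 1$, let $\mathcal{B}_n(\mathbb{Z})$ be the simplicial complex whose simplices are the nonempty finite sets $\{u_1,\dots,u_k\}\subset\mathbb{Z}^n$ that are contained in some basis of the free abelian group $\mathbb{Z}^n$. Let $\Gamma_n[2]$ be the kernel of the reduction map $\mathrm{GL}(n,\mathbb{Z})\to\mathrm{GL}(n,\mathbb{Z}/2)$, let $v_1,\dots,v_n$ be the standard basis of $\mathbb{Z}^n$, and call a set of the form $\{Mv_1,\dots,Mv_n\}$ with $M\in\Gamma_n[2]$ a $\pi$-basis of $\mathbb{Z}^n$. Let $\mathcal{B}^\pi_n(\mathbb{Z})$ be the subcomplex of $\mathcal{B}_n(\mathbb{Z})$ whose simplices are the nonempty subsets of $\pi$-bases. Let $\mathcal{Y}$ (the augmented partial $\pi$-basis complex for $\mathbb{Z}^3$) be the full subcomplex of $\mathcal{B}_3(\mathbb{Z})$ spanned by the vertices of $\mathcal{B}^\pi_3(\mathbb{Z})$ together with all vertices $u=(u^{(1)},u^{(2)},u^{(3)})$ of $\mathcal{B}_3(\mathbb{Z})$ for which $u^{(1)}$ and $u^{(2)}$ are odd and $u^{(3)}$ is even. **Theorem.**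 The complex $\mathcal{Y}$ is simply connected; that is, its geometric realization (with the weak topology) is path-connected and has trivial fundamental group. -/

import Mathlib

namespace PreAbstractSimplicialComplex

variable {ι : Type*}

/-- The vertices of a simplicial complex: the points that span a face. -/
def vertexSet (K : PreAbstractSimplicialComplex ι) : Set ι :=
  {v | {v} ∈ K.faces}

/-- The full subcomplex of `K` spanned by a set `V`: all faces of `K` whose vertices lie in `V`. -/
def fullSubcomplex (K : PreAbstractSimplicialComplex ι) (V : Set ι) :
    PreAbstractSimplicialComplex ι where
  faces := {s | s ∈ K.faces ∧ (s : Set ι) ⊆ V}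
  isRelLowerSet_faces := fun _ hs =>
    ⟨(K.isRelLowerSet_faces hs.1).1, fun _ hts ht =>
      ⟨(K.isRelLowerSet_faces hs.1).2 hts ht, (Finset.coe_subset.2 hts).trans hs.2⟩⟩

/-- The closed geometric simplex on a finite vertex set `s`, in barycentric coordinates, with the
topology of a subspace of `ι → ℝ` (only the finitely many coordinates in `s` can be nonzero, so
this is the usual Euclidean simplex). -/
def closedSimplex (s : Finset ι) : Set (ι → ℝ) :=
  {x | (∀ i, 0 ≤ x i) ∧ (∀ i, i ∉ s → x i = 0) ∧ ∑ i ∈ s, x i = 1}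

/-- The geometric realization of a simplicial complex: the union of the closed simplices on its
faces. It is a type of its own, so that it does not carry the subspace topology of `ι → ℝ`. -/
def Realization (K : PreAbstractSimplicialComplex ι) : Type _ :=
  {x : ι → ℝ // ∃ s ∈ K.faces, x ∈ closedSimplex s}

/-- The inclusion of a closed simplex into the realization. -/
def faceInclusion (K : PreAbstractSimplicialComplex ι) (s : K.faces) :
    closedSimplex (s : Finset ι) → K.Realization :=
  fun x => ⟨x.1, s.1, s.2, x.2⟩

/-- The weak topology on the realization: a set is open if and only if its preimage in each
closed simplex is open. -/
instance instTopologicalSpaceRealization (K : PreAbstractSimplicialComplex ι) :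
    TopologicalSpace K.Realization :=
  ⨆ s : K.faces, TopologicalSpace.coinduced (K.faceInclusion s) inferInstance

end PreAbstractSimplicialComplex

namespace PalindromicComplex

/-- The complex `ℬₙ(ℤ)` of partial bases of `ℤⁿ`: its simplices are the nonempty finite subsets of
bases of the free abelian group `ℤⁿ`. -/
def partialBasisComplex (n : ℕ) : PreAbstractSimplicialComplex (Fin n → ℤ) where
  faces := {s | s.Nonempty ∧
    ∃ b : Module.Basis (Fin n) ℤ (Fin n → ℤ), (s : Set (Fin n → ℤ)) ⊆ Set.range b}
  isRelLowerSet_faces := fun _ hs =>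
    ⟨hs.1, fun _ hts ht =>
      ⟨ht, hs.2.imp fun _ hb => (Finset.coe_subset.2 hts).trans hb⟩⟩

/-- The principal level 2 congruence subgroup `Γₙ[2]` of `GL(n, ℤ)`. -/
def levelTwo (n : ℕ) : Subgroup (Matrix.GeneralLinearGroup (Fin n) ℤ) :=
  (Matrix.GeneralLinearGroup.map (n := Fin n) (Int.castRingHom (ZMod 2))).ker

/-- A `π`-basis of `ℤⁿ` is a set of the form `{M v₁, …, M vₙ}` with `M ∈ Γₙ[2]`, where
`v₁, …, vₙ` is the standard basis. -/
def IsPiBasis {n : ℕ} (B : Set (Fin n → ℤ)) : Prop :=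
  ∃ M ∈ levelTwo n,
    B = Set.range fun j : Fin n => (M : Matrix (Fin n) (Fin n) ℤ).mulVec (Pi.single j 1)

/-- The complex of partial `π`-bases of `ℤⁿ`: its simplices are the nonempty finite subsets of
`π`-bases. -/
def partialPiBasisComplex (n : ℕ) : PreAbstractSimplicialComplex (Fin n → ℤ) where
  faces := {s | s.Nonempty ∧ ∃ B : Set (Fin n → ℤ), IsPiBasis B ∧ (s : Set (Fin n → ℤ)) ⊆ B}
  isRelLowerSet_faces := fun _ hs =>
    ⟨hs.1, fun _ hts ht =>
      ⟨ht, hs.2.imp fun _ hB => ⟨hB.1, (Finset.coe_subset.2 hts).trans hB.2⟩⟩⟩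

/-- The augmented partial `π`-basis complex `𝒴` for `ℤ³`: the full subcomplex of `ℬ₃(ℤ)` spanned by
the vertices of the complex of partial `π`-bases and the vertices `u` of `ℬ₃(ℤ)` whose first two
coordinates are odd and whose third coordinate is even. -/
def augmentedComplex : PreAbstractSimplicialComplex (Fin 3 → ℤ) :=
  (partialBasisComplex 3).fullSubcomplex
    ((partialPiBasisComplex 3).vertexSet ∪
      {u | u ∈ (partialBasisComplex 3).vertexSet ∧ Odd (u 0) ∧ Odd (u 1) ∧ Even (u 2)})

end PalindromicComplex

/-! Use the height $|u^{(3)}|$ of a vertex $u$ as a combinatorial Morse function. A vertex of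
$\mathcal Y$ is a primitive vector whose reduction mod 2 is $e_1$, $e_2$, $e_1+e_2$ or $e_3$, and
three such vectors span a triangle as soon as their determinant is $\pm1$. Edges of height $0$ lie
in a cone with apex $e_3$ (`cone_mem`). For $v$ of positive height, the lower neighbours of $v$
project to primitive vectors of $\mathbb Z^3/v\cong\mathbb Z^2$. Division with remainder by
$v^{(3)}$ lifts them back below $v$, and the Euclidean algorithm, adapted to the parity conditions,
joins any of them to a fixed one (`descending_link`). An edge between distinct vertices of equal
positive height spans a triangle with a lower vertex (`exists_lower_of_horizontal`). These facts
imply simple connectivity by induction on the height (`simplyConnectedSpace_of_height`). The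
induction is run on group-valued 1-cocycles: if every cocycle on a connected complex is a
coboundary, applying this to the tautological cocycle in $\pi_1$ gives a coherent choice of path
classes to all points, so all paths with the same endpoints are homotopic
(`simplyConnectedSpace_of_cocycle`). -/

namespace PreAbstractSimplicialComplex

open Topology unitInterval

universe u

variable {ι : Type u}

/-! ### Closed simplices and the weak topology. -/

theorem isClosed_closedSimplex (s : Finset ι) : IsClosed (closedSimplex s) := by
  have h : closedSimplex s = {x | ∀ i, 0 ≤ x i} ∩ {x | ∀ i, i ∉ s → x i = 0} ∩
      {x | ∑ i ∈ s, x i = 1} := by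
    ext x; simp [closedSimplex, and_assoc]
  rw [h]
  refine (IsClosed.inter ?_ ?_).inter ?_
  · simp only [Set.ofPred_forall]
    exact isClosed_iInter fun i => isClosed_le continuous_const (continuous_apply i)
  · simp only [Set.ofPred_forall]
    exact isClosed_iInter fun i => isClosed_iInter fun _ =>
      isClosed_eq (continuous_apply i) continuous_const
  · exact isClosed_eq (continuous_finsetSum _ fun i _ => continuous_apply i) continuous_const

theorem convex_closedSimplex (s : Finset ι) : Convex ℝ (closedSimplex s) := by
  rintro x ⟨hx0, hx, hx1⟩ y ⟨hy0, hy, hy1⟩ a b ha hb hab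
  refine ⟨fun i => ?_, fun i hi => ?_, ?_⟩
  · exact add_nonneg (mul_nonneg ha (hx0 i)) (mul_nonneg hb (hy0 i))
  · simp [hx i hi, hy i hi]
  · simp only [Pi.add_apply, Pi.smul_apply, smul_eq_mul, Finset.sum_add_distrib, ← Finset.mul_sum,
      hx1, hy1, mul_one, hab]

theorem closedSimplex_mono {s t : Finset ι} (h : s ⊆ t) : closedSimplex s ⊆ closedSimplex t :=
  fun _ hx => ⟨hx.1, fun i hi => hx.2.1 i fun h' => hi (h h'), by
    rw [← Finset.sum_subset h fun i _ hi => hx.2.1 i hi]; exact hx.2.2⟩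

theorem single_mem_closedSimplex [DecidableEq ι] {s : Finset ι} {v : ι} (hv : v ∈ s) :
    (Pi.single v 1 : ι → ℝ) ∈ closedSimplex s := by
  refine ⟨fun i => ?_, fun i hi => ?_, ?_⟩
  · by_cases h : i = v
    · subst h; simp
    · simp [h]
  · have : i ≠ v := fun h => hi (h ▸ hv)
    simp [this]
  · rw [Finset.sum_eq_single_of_mem v hv fun i _ hi => by simp [hi]]
    simp

theorem mem_of_pos {s : Finset ι} {x : ι → ℝ} (hx : x ∈ closedSimplex s) {v : ι} (hv : 0 < x v) :
    v ∈ s := by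
  by_contra h
  exact hv.ne' (hx.2.1 v h)

theorem exists_pos {s : Finset ι} {x : ι → ℝ} (hx : x ∈ closedSimplex s) : ∃ v, 0 < x v := by
  by_contra! h
  have := hx.2.2
  rw [Finset.sum_eq_zero fun i _ => le_antisymm (h i) (hx.1 i)] at this
  exact zero_ne_one this

variable (K : PreAbstractSimplicialComplex ι)

theorem mem_faces_of_subset {s t : Finset ι} (hs : s ∈ K.faces) (hts : t ⊆ s) (ht : t.Nonempty) :
    t ∈ K.faces :=
  (K.isRelLowerSet_faces hs).2 hts ht

theorem continuous_faceInclusion (s : K.faces) : Continuous (K.faceInclusion s) :=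
  continuous_iSup_rng (i := s) continuous_coinduced_rng

theorem isOpen_iff {U : Set K.Realization} :
    IsOpen U ↔ ∀ s : K.faces, IsOpen (K.faceInclusion s ⁻¹' U) := by
  rw [isOpen_iSup_iff]
  simp only [isOpen_coinduced]

theorem isClosed_iff {U : Set K.Realization} :
    IsClosed U ↔ ∀ s : K.faces, IsClosed (K.faceInclusion s ⁻¹' U) := by
  simp only [← isOpen_compl_iff, K.isOpen_iff, Set.preimage_compl]

theorem continuous_coords : Continuous fun x : K.Realization => x.1 := by
  refine continuous_iSup_dom.2 fun s => continuous_coinduced_dom.2 ?_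
  exact continuous_subtype_val

theorem isOpen_openStar (v : ι) : IsOpen {x : K.Realization | 0 < x.1 v} :=
  isOpen_lt continuous_const ((continuous_apply v).comp K.continuous_coords)

/-- A map into the realization with image in finitely many faces is continuous as soon as its
barycentric coordinates are. -/
theorem continuous_of_finite {X : Type*} [TopologicalSpace X] {f : X → K.Realization}
    {F : Set (Finset ι)} (hF : F.Finite) (hFK : F ⊆ K.faces) (hc : Continuous fun x => (f x).1)
    (hf : ∀ x, ∃ s ∈ F, (f x).1 ∈ closedSimplex s) : Continuous f := by
  have : Finite F := hF
  refine (locallyFinite_of_finite fun s : F => {x | (f x).1 ∈ closedSimplex s.1}).continuous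
    ?_ ?_ ?_
  · refine Set.eq_univ_of_forall fun x => ?_
    obtain ⟨s, hs, hx⟩ := hf x
    exact Set.mem_iUnion.2 ⟨⟨s, hs⟩, hx⟩
  · exact fun s => (isClosed_closedSimplex s.1).preimage hc
  · intro s
    rw [continuousOn_iff_continuous_domRestrict]
    exact (K.continuous_faceInclusion ⟨s.1, hFK s.2⟩).comp
      (Continuous.subtype_mk (hc.comp continuous_subtype_val) fun x => x.2)

theorem finite_support (x : K.Realization) : {i | 0 < x.1 i}.Finite := by
  obtain ⟨s, _, hx⟩ := x.2
  exact s.finite_toSet.subset fun i hi => mem_of_pos hx hi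

/-- The set of vertices at which a point has a nonzero barycentric coordinate. -/
noncomputable def carrier (x : K.Realization) : Finset ι := (K.finite_support x).toFinset

theorem mem_carrier {x : K.Realization} {i : ι} : i ∈ K.carrier x ↔ 0 < x.1 i := by
  simp [carrier]

theorem carrier_subset {x : K.Realization} {s : Finset ι} (hx : x.1 ∈ closedSimplex s) :
    K.carrier x ⊆ s :=
  fun _ hi => mem_of_pos hx (K.mem_carrier.1 hi)

theorem mem_closedSimplex_carrier (x : K.Realization) : x.1 ∈ closedSimplex (K.carrier x) := by
  obtain ⟨s, _, hx⟩ := x.2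
  have h0 : ∀ i, i ∉ K.carrier x → x.1 i = 0 := fun i hi =>
    le_antisymm (not_lt.1 fun h => hi (K.mem_carrier.2 h)) (hx.1 i)
  exact ⟨hx.1, h0, by rw [Finset.sum_subset (K.carrier_subset hx) fun i _ hi => h0 i hi, hx.2.2]⟩

theorem carrier_mem_faces (x : K.Realization) : K.carrier x ∈ K.faces := by
  obtain ⟨s, hs, hx⟩ := x.2
  obtain ⟨v, hv⟩ := exists_pos hx
  exact K.mem_faces_of_subset hs (K.carrier_subset hx) ⟨v, K.mem_carrier.2 hv⟩

/-- A compact subset of the realization meets only finitely many open cells. -/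
theorem finite_carrier_image {C : Set K.Realization} (hC : IsCompact C) :
    (K.carrier '' C).Finite := by
  by_contra hinf
  -- Pick one point for each carrier. A face contains finitely many carriers, so every subset of `A`
  -- meets it in a finite set and is closed; an infinite `A` would then have no accumulation point,
  -- against compactness.
  obtain ⟨A, hAC, hA⟩ := Set.exists_subset_bijOn C K.carrier
  have hAinf : A.Infinite := fun h => hinf (hA.image_eq ▸ h.image _)
  have hclosed : ∀ B ⊆ A, IsClosed B := by
    intro B hB
    refine K.isClosed_iff.2 fun s => Set.Finite.isClosed ?_
    refine Set.Finite.of_finite_image (f := fun x => K.carrier (K.faceInclusion s x)) ?_ ?_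
    · refine s.1.powerset.finite_toSet.subset ?_
      rintro _ ⟨x, _, rfl⟩
      exact Finset.mem_coe.2 (Finset.mem_powerset.2 (K.carrier_subset x.2))
    · intro x hx y hy hxy
      have := hA.injOn (hB hx) (hB hy) hxy
      exact Subtype.ext (congrArg (fun z : K.Realization => z.1) this)
  obtain ⟨x, _, hx⟩ := hAinf.exists_accPt_of_subset_isCompact hC hAC
  rw [accPt_principal_iff_clusterPt, ← mem_closure_iff_clusterPt,
    (hclosed _ Set.sdiff_subset).closure_eq] at hx
  exact hx.2 rfl

/-! ### Homotopies inside faces and open stars. -/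

/-- Two paths with the same endpoints inside a star convex set that is covered by finitely many
faces are homotopic. -/
theorem homotopic_of_starConvex {X : Set (ι → ℝ)} {x₀ : ι → ℝ} (hx₀ : x₀ ∈ X)
    (hX : StarConvex ℝ x₀ X) {F : Set (Finset ι)} (hF : F.Finite) (hFK : F ⊆ K.faces)
    (hXF : ∀ x ∈ X, ∃ s ∈ F, x ∈ closedSimplex s) {a b : K.Realization} (γ γ' : Path a b)
    (hγ : ∀ t, (γ t).1 ∈ X) (hγ' : ∀ t, (γ' t).1 ∈ X) : γ.Homotopic γ' := by
  have := hX.contractibleSpace ⟨x₀, hx₀⟩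
  let φ : C(X, K.Realization) :=
    ⟨fun x => ⟨x.1, (hXF x.1 x.2).imp fun s hs => ⟨hFK hs.1, hs.2⟩⟩,
      K.continuous_of_finite hF hFK continuous_subtype_val fun x => hXF x.1 x.2⟩
  have ha : a.1 ∈ X := by simpa using hγ 0
  have hb : b.1 ∈ X := by simpa using hγ 1
  let lift : (δ : Path a b) → (∀ t, (δ t).1 ∈ X) → Path (⟨a.1, ha⟩ : X) ⟨b.1, hb⟩ := fun δ hδ =>
    { toFun := fun t => ⟨(δ t).1, hδ t⟩
      continuous_toFun := (K.continuous_coords.comp δ.continuous).subtype_mk _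
      source' := by simp
      target' := by simp }
  exact (SimplyConnectedSpace.paths_homotopic (lift γ hγ) (lift γ' hγ')).map φ

theorem homotopic_of_mem_closedSimplex {s : Finset ι} (hs : s ∈ K.faces) {a b : K.Realization}
    (γ γ' : Path a b) (hγ : ∀ t, (γ t).1 ∈ closedSimplex s)
    (hγ' : ∀ t, (γ' t).1 ∈ closedSimplex s) : γ.Homotopic γ' :=
  K.homotopic_of_starConvex (hγ 0) ((convex_closedSimplex s).starConvex (hγ 0))
    (Set.finite_singleton s) (Set.singleton_subset_iff.2 hs) (fun _ hx => ⟨s, rfl, hx⟩) γ γ' hγ hγ'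

/-- Open stars of vertices are simply connected. -/
theorem homotopic_of_mem_openStar {v : ι} {a b : K.Realization}
    (γ γ' : Path a b) (hγ : ∀ t, 0 < (γ t).1 v) (hγ' : ∀ t, 0 < (γ' t).1 v) :
    γ.Homotopic γ' := by
  classical
  let F := K.carrier '' (Set.range γ ∪ Set.range γ')
  have hF : F.Finite := K.finite_carrier_image
    ((isCompact_range γ.continuous).union (isCompact_range γ'.continuous))
  have hFK : F ⊆ K.faces := by
    rintro _ ⟨x, _, rfl⟩
    exact K.carrier_mem_faces x
  -- Only faces containing `v` are kept, which makes `X` star-shaped about the vertex `v`; there are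
  -- finitely many of them, so continuity into the weak topology can be checked on coordinates.
  let X : Set (ι → ℝ) := {x | 0 < x v ∧ ∃ s ∈ F, v ∈ s ∧ x ∈ closedSimplex s}
  have mem : ∀ x ∈ Set.range γ ∪ Set.range γ', 0 < x.1 v → x.1 ∈ X := fun x hx hv =>
    ⟨hv, _, ⟨x, hx, rfl⟩, K.mem_carrier.2 hv, K.mem_closedSimplex_carrier x⟩
  have hγX : ∀ t, (γ t).1 ∈ X := fun t => mem _ (Or.inl ⟨t, rfl⟩) (hγ t)
  have hγX' : ∀ t, (γ' t).1 ∈ X := fun t => mem _ (Or.inr ⟨t, rfl⟩) (hγ' t)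
  refine K.homotopic_of_starConvex (X := X) (x₀ := Pi.single v 1) ?_ ?_ hF hFK
    (fun x hx => ?_) γ γ' hγX hγX'
  · obtain ⟨_, s, hs, hv, _⟩ := hγX 0
    exact ⟨by simp, s, hs, hv, single_mem_closedSimplex hv⟩
  · rintro y ⟨hy, s, hs, hv, hys⟩ p q hp hq hpq
    refine ⟨?_, s, hs, hv, convex_closedSimplex s (single_mem_closedSimplex hv) hys hp hq hpq⟩
    simp only [Pi.add_apply, Pi.smul_apply, Pi.single_eq_same, smul_eq_mul, mul_one]
    rcases hp.eq_or_lt with rfl | hp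
    · simp_all
    · positivity
  · obtain ⟨_, s, hs, _, h⟩ := hx
    exact ⟨s, hs, h⟩

/-- Two points of a common face are joined by a path in that face; if both points lie in the open
star of `v`, so does the path. -/
theorem exists_path_of_mem_closedSimplex {s : Finset ι} (hs : s ∈ K.faces) {a b : K.Realization}
    (ha : a.1 ∈ closedSimplex s) (hb : b.1 ∈ closedSimplex s) :
    ∃ γ : Path a b, (∀ t, (γ t).1 ∈ closedSimplex s) ∧
      ∀ v, 0 < a.1 v → 0 < b.1 v → ∀ t, 0 < (γ t).1 v := by
  have mem : ∀ t : I, (1 - (t : ℝ)) • a.1 + (t : ℝ) • b.1 ∈ closedSimplex s := fun t =>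
    convex_closedSimplex s ha hb (sub_nonneg.2 t.2.2) t.2.1 (by ring)
  refine ⟨⟨⟨fun t => ⟨_, s, hs, mem t⟩, ?_⟩, ?_, ?_⟩, mem, fun v hav hbv t => ?_⟩
  · refine K.continuous_of_finite (Set.finite_singleton s) (Set.singleton_subset_iff.2 hs) ?_
      fun t => ⟨s, rfl, mem t⟩
    fun_prop
  · exact Subtype.ext (by simp)
  · exact Subtype.ext (by simp)
  · change 0 < ((1 - (t : ℝ)) • a.1 + (t : ℝ) • b.1) v
    have h := (convex_Ioi (0 : ℝ)) hav hbv (sub_nonneg.2 t.2.2) t.2.1 (by ring)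
    simpa using h

theorem _root_.Path.trans_forall {X : Type*} [TopologicalSpace X] {a b c : X} {γ : Path a b}
    {γ' : Path b c} {P : X → Prop} (h : ∀ t, P (γ t)) (h' : ∀ t, P (γ' t)) (t : I) :
    P (γ.trans γ' t) := by
  rw [Path.trans_apply]
  split_ifs
  exacts [h _, h' _]

open Path.Homotopic.Quotient in
/-- A compatible choice of homotopy classes of paths from a base point to all points, which is
compatible with short paths, is compatible with all paths. -/
theorem trans_mk_eq_of_openStar {x₀ : K.Realization}
    (T : ∀ a : K.Realization, Path.Homotopic.Quotient x₀ a)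
    (hT : ∀ (a b : K.Realization) (γ : Path a b) (v : ι), (∀ t, 0 < (γ t).1 v) →
      (T a).trans (Path.Homotopic.Quotient.mk γ) = T b) {a b : K.Realization} (γ : Path a b) :
    (T a).trans (Path.Homotopic.Quotient.mk γ) = T b := by
  -- Lebesgue subdivision: each piece of the path lies in a single open star.
  obtain ⟨t, ht0, hmono, ⟨n, hn⟩, hcover⟩ := exists_monotone_Icc_subset_open_cover_unitInterval
    (c := fun v => γ ⁻¹' {x | 0 < x.1 v})
    (fun v => (K.isOpen_openStar v).preimage γ.continuous) (fun s _ => by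
      obtain ⟨r, _, hr⟩ := (γ s).2
      obtain ⟨v, hv⟩ := exists_pos hr
      exact Set.mem_iUnion.2 ⟨v, hv⟩)
  have key : ∀ k, (T (γ 0)).trans (Path.Homotopic.Quotient.mk (γ.subpath 0 (t k))) =
      T (γ (t k)) := by
    intro k
    induction k with
    | zero => rw [ht0, Path.subpath_self, mk_refl, trans_refl]
    | succ k ih =>
      obtain ⟨v, hv⟩ := hcover k
      have hstep := hT _ _ (γ.subpath (t k) (t (k + 1))) v fun s => by
        have hs : γ.subpath (t k) (t (k + 1)) s ∈
            Set.range (γ.subpath (t k) (t (k + 1))) := ⟨s, rfl⟩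
        rw [Path.range_subpath_of_le _ _ _ (hmono k.le_succ)] at hs
        obtain ⟨r, hr, hrs⟩ := hs
        rw [← hrs]
        exact hv hr
      have hsub : Path.Homotopic.Quotient.mk (γ.subpath 0 (t (k + 1))) =
          (Path.Homotopic.Quotient.mk (γ.subpath 0 (t k))).trans
            (Path.Homotopic.Quotient.mk (γ.subpath (t k) (t (k + 1)))) := by
        rw [← mk_trans, eq]
        exact ⟨(Path.Homotopy.subpathTransSubpath γ 0 (t k) (t (k + 1))).symm⟩
      rw [hsub, ← trans_assoc, ih, hstep]
  have := key n
  rw [hn n le_rfl, Path.subpath_zero_one] at this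
  have aux : ∀ {a' b' : K.Realization} (ha : a' = a) (hb : b' = b),
      (T a').trans (Path.Homotopic.Quotient.mk (γ.cast ha hb)) = T b' →
      (T a).trans (Path.Homotopic.Quotient.mk γ) = T b := by
    rintro _ _ rfl rfl h
    exact h
  exact aux γ.source γ.target this

/-! ### Simple connectivity from cocycles and from height functions. -/

open Path.Homotopic.Quotient in
/-- A simplicial complex has simply connected realization if its graph of edges is connected and
every group valued `1`-cocycle on it is a coboundary. -/
theorem simplyConnectedSpace_of_cocycle [DecidableEq ι] {b : ι} (hb : {b} ∈ K.faces)
    (hconn : ∀ v, {v} ∈ K.faces → Relation.ReflTransGen (fun x y => {x, y} ∈ K.faces) b v)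
    (hcob : ∀ (G : Type u) [Group G] (g : ι → ι → G),
      (∀ x y z, {x, y, z} ∈ K.faces → g x y * g y z = g x z) →
      ∃ p : ι → G, ∀ x y, {x, y} ∈ K.faces → p x * g x y = p y) :
    SimplyConnectedSpace K.Realization := by
  let b₀ : K.Realization := ⟨Pi.single b 1, {b}, hb, single_mem_closedSimplex (by simp)⟩
  have hpt : ∀ v : ι, ∃ x : K.Realization, {v} ∈ K.faces → x.1 = Pi.single v 1 := fun v => by
    by_cases hv : {v} ∈ K.faces
    · exact ⟨⟨_, {v}, hv, single_mem_closedSimplex (by simp)⟩, fun _ => rfl⟩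
    · exact ⟨b₀, fun h => absurd h hv⟩
  choose pt hpt using hpt
  have hptmem : ∀ {s : Finset ι} {v : ι}, s ∈ K.faces → v ∈ s → (pt v).1 ∈ closedSimplex s := by
    intro s v hs hv
    rw [hpt v (K.mem_faces_of_subset hs (by simpa using hv) (by simp))]
    exact single_mem_closedSimplex hv
  have hσ : ∀ (a : K.Realization) (v : ι), 0 < a.1 v →
      ∃ γ : Path (pt v) a, (∀ t, (γ t).1 ∈ closedSimplex (K.carrier a)) ∧ ∀ t, 0 < (γ t).1 v := by
    intro a v hv
    have hva : v ∈ K.carrier a := K.mem_carrier.2 hv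
    obtain ⟨γ, h1, h2⟩ := K.exists_path_of_mem_closedSimplex (K.carrier_mem_faces a)
      (hptmem (K.carrier_mem_faces a) hva) (K.mem_closedSimplex_carrier a)
    refine ⟨γ, h1, h2 v ?_ hv⟩
    rw [hpt v (K.mem_faces_of_subset (K.carrier_mem_faces a) (by simpa using hva) (by simp))]
    simp
  have hedge : ∀ x y, {x, y} ∈ K.faces →
      ∃ γ : Path (pt x) (pt y), ∀ t, (γ t).1 ∈ closedSimplex {x, y} := fun x y h =>
    (K.exists_path_of_mem_closedSimplex h (hptmem h (by simp)) (hptmem h (by simp))).imp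
      fun _ hγ => hγ.1
  have hptb : pt b = b₀ := Subtype.ext (hpt b hb)
  have hpc : PathConnectedSpace K.Realization := by
    have hjoin : ∀ a : K.Realization, Joined b₀ a := by
      intro a
      obtain ⟨v, hv⟩ := exists_pos (K.mem_closedSimplex_carrier a)
      have hva : {v} ∈ K.faces := K.mem_faces_of_subset (K.carrier_mem_faces a)
        (by simpa using K.mem_carrier.2 hv) (by simp)
      refine Joined.trans (y := pt v) ?_ ⟨(hσ a v hv).choose⟩
      rw [← hptb]
      have hch := hconn v hva
      clear hva hv
      induction hch with
      | refl => exact Joined.refl _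
      | tail _ h ih => exact ih.trans ⟨(hedge _ _ h).choose⟩
    exact ⟨⟨b₀⟩, fun x y => (hjoin x).symm.trans (hjoin y)⟩
  have he : ∀ x y, ∃ e : Path.Homotopic.Quotient (pt x) (pt y), {x, y} ∈ K.faces →
      ∃ γ : Path (pt x) (pt y), Path.Homotopic.Quotient.mk γ = e ∧
        ∀ t, (γ t).1 ∈ closedSimplex {x, y} := fun x y => by
    by_cases h : {x, y} ∈ K.faces
    · obtain ⟨γ, hγ⟩ := hedge x y h
      exact ⟨Path.Homotopic.Quotient.mk γ, fun _ => ⟨γ, rfl, hγ⟩⟩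
    · exact ⟨Path.Homotopic.Quotient.mk (PathConnectedSpace.somePath _ _), fun h' => absurd h' h⟩
  choose e he using he
  let c : ∀ x, Path.Homotopic.Quotient b₀ (pt x) := fun x =>
    Path.Homotopic.Quotient.mk (PathConnectedSpace.somePath _ _)
  -- Multiplication in the fundamental group is concatenation in the reverse order, hence the edge
  -- class from `y` to `x`.
  let g : ι → ι → FundamentalGroup K.Realization b₀ := fun x y =>
    (c y).trans ((e y x).trans (c x).symm)
  obtain ⟨p, hp⟩ := hcob (FundamentalGroup K.Realization b₀) g fun x y z h => by
    have hzy : {z, y} ∈ K.faces := K.mem_faces_of_subset h (by grind) (by simp)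
    have hyx : {y, x} ∈ K.faces := K.mem_faces_of_subset h (by grind) (by simp)
    have hzx : {z, x} ∈ K.faces := K.mem_faces_of_subset h (by grind) (by simp)
    obtain ⟨γ₁, h₁, hγ₁⟩ := he z y hzy
    obtain ⟨γ₂, h₂, hγ₂⟩ := he y x hyx
    obtain ⟨γ₃, h₃, hγ₃⟩ := he z x hzx
    have key : (e z y).trans (e y x) = e z x := by
      rw [← h₁, ← h₂, ← h₃, ← mk_trans, eq]
      refine K.homotopic_of_mem_closedSimplex h _ _
        (Path.trans_forall (P := fun w : K.Realization => w.1 ∈ closedSimplex {x, y, z})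
          (fun t => closedSimplex_mono (by grind) (hγ₁ t))
          (fun t => closedSimplex_mono (by grind) (hγ₂ t)))
        (fun t => closedSimplex_mono (by grind) (hγ₃ t))
    have : ((c z).trans ((e z y).trans (c y).symm)).trans ((c y).trans ((e y x).trans (c x).symm)) =
        (c z).trans ((e z x).trans (c x).symm) := by
      rw [← key]; grind
    exact this
  -- Correcting `c` by the potential makes the classes to vertices compatible with all edges.
  let P : ∀ x, Path.Homotopic.Quotient b₀ (pt x) := fun x =>
    Path.Homotopic.Quotient.trans (Path.Homotopic.Quotient.symm (p x)) (c x)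
  have hP : ∀ x y, {x, y} ∈ K.faces → (P y).trans (e y x) = P x := by
    intro x y h
    have h1 : Path.Homotopic.Quotient.trans ((c y).trans ((e y x).trans (c x).symm)) (p x) = p y :=
      hp x y h
    change Path.Homotopic.Quotient.trans (Path.Homotopic.Quotient.trans
      (Path.Homotopic.Quotient.symm (p y)) (c y)) (e y x) =
      Path.Homotopic.Quotient.trans (Path.Homotopic.Quotient.symm (p x)) (c x)
    have h2 : (c y).trans (e y x) = Path.Homotopic.Quotient.trans (p y)
        (Path.Homotopic.Quotient.trans (Path.Homotopic.Quotient.symm (p x)) (c x)) := by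
      rw [← h1]
      grind
    rw [trans_assoc, h2, ← trans_assoc, symm_trans, refl_trans]
  -- The class at `a` does not depend on the vertex of the carrier through which it is reached: two
  -- such vertices span an edge of that face.
  have hT : ∀ a : K.Realization, ∃ T : Path.Homotopic.Quotient b₀ a,
      ∀ (v : ι) (γ : Path (pt v) a), 0 < a.1 v → (∀ t, 0 < (γ t).1 v) →
        (P v).trans (Path.Homotopic.Quotient.mk γ) = T := by
    intro a
    obtain ⟨w, hw⟩ := exists_pos (K.mem_closedSimplex_carrier a)
    obtain ⟨δ, hδ, _⟩ := hσ a w hw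
    refine ⟨(P w).trans (Path.Homotopic.Quotient.mk δ), fun v γ hv hγ => ?_⟩
    obtain ⟨γ', hγ', hγ''⟩ := hσ a v hv
    have hsub : ({v, w} : Finset ι) ⊆ K.carrier a := by
      simp [Finset.insert_subset_iff, K.mem_carrier, hv, hw]
    have hwv : {w, v} ∈ K.faces :=
      K.mem_faces_of_subset (K.carrier_mem_faces a) (by grind) (by simp)
    obtain ⟨ε, hε, hεm⟩ := he w v hwv
    rw [eq.2 (K.homotopic_of_mem_openStar γ γ' hγ hγ''),
      ← hP v w (by rwa [Finset.pair_comm]), trans_assoc, ← hε, ← mk_trans]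
    congr 1
    rw [eq]
    exact K.homotopic_of_mem_closedSimplex (K.carrier_mem_faces a) _ _
        (Path.trans_forall (P := fun w : K.Realization => w.1 ∈ closedSimplex (K.carrier a))
          (fun t => closedSimplex_mono (by grind) (hεm t)) hγ') hδ
  choose T hT using hT
  have hTγ : ∀ {x y : K.Realization} (γ : Path x y),
      (T x).trans (Path.Homotopic.Quotient.mk γ) = T y := by
    refine K.trans_mk_eq_of_openStar T fun x y γ v hγ => ?_
    have hx : 0 < x.1 v := by simpa using hγ 0
    have hy : 0 < y.1 v := by simpa using hγ 1
    obtain ⟨δ, _, hδ⟩ := hσ x v hx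
    rw [← hT x v δ hx hδ, trans_assoc, ← mk_trans]
    exact hT y v _ hy (Path.trans_forall (P := fun w : K.Realization => 0 < w.1 v) hδ hγ)
  rw [simply_connected_iff_paths_homotopic']
  refine ⟨hpc, fun {x y} γ γ' => ?_⟩
  rw [← eq]
  have h := (hTγ γ).trans (hTγ γ').symm
  calc Path.Homotopic.Quotient.mk γ
    _ = (T x).symm.trans ((T x).trans (Path.Homotopic.Quotient.mk γ)) := by grind
    _ = (T x).symm.trans ((T x).trans (Path.Homotopic.Quotient.mk γ')) := by rw [h]
    _ = Path.Homotopic.Quotient.mk γ' := by grind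

section Faces

variable {K} [DecidableEq ι] {x y z : ι}

theorem left_mem_faces (h : {x, y} ∈ K.faces) : {x} ∈ K.faces :=
  K.mem_faces_of_subset h (by simp) (by simp)

theorem right_mem_faces (h : {x, y} ∈ K.faces) : {y} ∈ K.faces :=
  K.mem_faces_of_subset h (by simp) (by simp)

theorem pair_mem_faces₁₂ (h : {x, y, z} ∈ K.faces) : {x, y} ∈ K.faces :=
  K.mem_faces_of_subset h (by grind) (by simp)

theorem pair_mem_faces₁₃ (h : {x, y, z} ∈ K.faces) : {x, z} ∈ K.faces :=
  K.mem_faces_of_subset h (by grind) (by simp)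

theorem triple_mem_faces_rotate (h : {x, y, z} ∈ K.faces) : {z, x, y} ∈ K.faces :=
  K.mem_faces_of_subset h (by grind) (by simp)

end Faces

/-- A simplicial complex has simply connected realization if it carries a height function for which
the edges of height `0` span a cone, the descending link of every vertex of positive height is
nonempty and connected, and every horizontal edge of positive height is a side of a triangle whose
third vertex is lower. -/
theorem simplyConnectedSpace_of_height [DecidableEq ι] (f : ι → ℕ) {b : ι} (hb : {b} ∈ K.faces)
    (hcone : ∀ x y, {x, y} ∈ K.faces → f x = 0 → f y = 0 → {b, x, y} ∈ K.faces)
    (hlink : ∀ v, {v} ∈ K.faces → 0 < f v → ∃ u₀, f u₀ < f v ∧ {u₀, v} ∈ K.faces ∧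
      ∀ u, {u, v} ∈ K.faces → f u < f v →
        Relation.ReflTransGen (fun x y => f x < f v ∧ f y < f v ∧ {x, y, v} ∈ K.faces) u u₀)
    (hedge : ∀ u v, u ≠ v → {u, v} ∈ K.faces → f u = f v → 0 < f v →
      ∃ w, f w < f v ∧ {u, v, w} ∈ K.faces) :
    SimplyConnectedSpace K.Realization := by
  have hlow : ∀ v, ∃ u, {v} ∈ K.faces → 0 < f v → f u < f v ∧ {u, v} ∈ K.faces ∧
      ∀ w, {w, v} ∈ K.faces → f w < f v →
        Relation.ReflTransGen (fun x y => f x < f v ∧ f y < f v ∧ {x, y, v} ∈ K.faces) w u := by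
    intro v
    by_cases h : {v} ∈ K.faces ∧ 0 < f v
    · obtain ⟨u, hu⟩ := hlink v h.1 h.2
      exact ⟨u, fun _ _ => hu⟩
    · exact ⟨v, fun h1 h2 => absurd ⟨h1, h2⟩ h⟩
  choose low hlow using hlow
  refine K.simplyConnectedSpace_of_cocycle hb ?_ ?_
  · have key : ∀ n, ∀ v, f v = n → {v} ∈ K.faces →
        Relation.ReflTransGen (fun x y => {x, y} ∈ K.faces) b v := by
      intro n
      induction n using Nat.strong_induction_on with
      | _ n ih =>
        intro v hn hv
        rcases Nat.eq_zero_or_pos (f v) with h0 | h0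
        · refine Relation.ReflTransGen.single ?_
          simpa using hcone v v (by simpa using hv) h0 h0
        · obtain ⟨h1, h2, _⟩ := hlow v hv h0
          exact (ih _ (hn ▸ h1) _ rfl (left_mem_faces h2)).tail h2
    exact fun v => key _ v rfl
  · intro G _ g hg
    have : ∃ p : ι → G, ∀ v, {v} ∈ K.faces →
        (f v = 0 → p v = g b v) ∧ (0 < f v → p v = p (low v) * g (low v) v) := by
      classical
      -- The potential is forced: start from the cone apex at height `0`, and extend upwards along
      -- the one chosen descending edge at each vertex.
      let p : ι → G := WellFounded.fix (measure f).wf fun v rec =>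
        if h : f (low v) < f v then rec (low v) h * g (low v) v else g b v
      have hp : ∀ v, p v = if f (low v) < f v then p (low v) * g (low v) v else g b v := by
        intro v
        exact (WellFounded.fix_eq _ _ v).trans (by split_ifs <;> rfl)
      refine ⟨p, fun v hv => ⟨fun h => ?_, fun h => ?_⟩⟩
      · rw [hp v, if_neg (by omega)]
      · rw [hp v, if_pos (hlow v hv h).1]
    obtain ⟨p, hp⟩ := this
    refine ⟨p, ?_⟩
    have hsymm : ∀ x y, {x, y} ∈ K.faces → p x * g x y = p y → p y * g y x = p x := by
      intro x y h hxy
      have h1 : g y x * g x y = g y y := hg y x y (by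
        rw [Finset.insert_eq_of_mem (by simp)]
        exact h)
      have h2 : g y y * g y y = g y y := hg y y y (by simpa using right_mem_faces h)
      rw [mul_eq_left] at h2
      rw [h2] at h1
      rw [← hxy, mul_assoc, mul_eq_one_comm.1 h1, mul_one]
    have hrefl : ∀ x, {x} ∈ K.faces → p x * g x x = p x := by
      intro x h
      have h2 := hg x x x (by simpa using h)
      rw [mul_eq_left] at h2 ⊢
      exact h2
    have key : ∀ n, ∀ x y, {x, y} ∈ K.faces → f x ≤ n → f y ≤ n → p x * g x y = p y := by
      intro n
      induction n with
      | zero =>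
        intro x y h hx hy
        have hx' : {x} ∈ K.faces := left_mem_faces h
        have hy' : {y} ∈ K.faces := right_mem_faces h
        rw [(hp x hx').1 (by omega), (hp y hy').1 (by omega)]
        exact hg b x y (hcone x y h (by omega) (by omega))
      | succ n ih =>
        -- Slide `u` through the descending link to `low v`. Each move crosses a triangle whose side
        -- opposite `v` has height at most `n`, where the induction hypothesis applies.
        have hdown : ∀ u v, {u, v} ∈ K.faces → f u < f v → f v = n + 1 → p u * g u v = p v := by
          intro u v h huv hv
          have hv' : {v} ∈ K.faces := right_mem_faces h
          rw [(hp v hv').2 (by omega)]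
          obtain ⟨h1, h2, h3⟩ := hlow v hv' (by omega)
          have h4 := h3 u h huv
          clear h3 h huv
          induction h4 using Relation.ReflTransGen.head_induction_on with
          | refl => rfl
          | head hxy _ IH =>
            obtain ⟨hx, hy, hface⟩ := hxy
            rw [← IH, ← hg _ _ _ hface, ← mul_assoc, ih _ _ _ (by omega) (by omega)]
            exact pair_mem_faces₁₂ hface
        intro x y h hx hy
        rcases lt_trichotomy (f x) (f y) with hlt | heq | hlt
        · rcases hy.eq_or_lt with hy | hy
          · exact hdown x y h hlt hy
          · exact ih x y h (by omega) (by omega)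
        · rcases eq_or_ne x y with rfl | hne
          · exact hrefl x (by simpa using h)
          rcases hy.eq_or_lt with hy | hy
          -- The two other sides of the triangle are descending, so the cocycle relation settles the
          -- horizontal one.
          · obtain ⟨w, hw, hface⟩ := hedge x y hne h heq (by omega)
            have hface' := triple_mem_faces_rotate hface
            have hwx : {w, x} ∈ K.faces := pair_mem_faces₁₂ hface'
            have hwy : {w, y} ∈ K.faces := pair_mem_faces₁₃ hface'
            rw [← hdown w x hwx (by omega) (by omega), mul_assoc,hg w x y hface']
            exact hdown w y hwy hw hy
          · exact ih x y h (by omega) (by omega)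
        · have h' : {y, x} ∈ K.faces := by rwa [Finset.pair_comm]
          rcases hx.eq_or_lt with hx | hx
          · exact hsymm y x h' (hdown y x h' hlt hx)
          · exact ih x y h (by omega) (by omega)
    exact fun x y h => key (max (f x) (f y)) x y h (le_max_left _ _) (le_max_right _ _)

end PreAbstractSimplicialComplex

/-! ### Bases of ℤ³ and determinants. -/

namespace PalindromicComplex

/-- The determinant of three vectors of `ℤ³`. -/
def tripleDet (x y z : Fin 3 → ℤ) : ℤ :=
  x 0 * (y 1 * z 2 - y 2 * z 1) - x 1 * (y 0 * z 2 - y 2 * z 0) + x 2 * (y 0 * z 1 - y 1 * z 0)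

/-- Reduction modulo `2` to one of `e₁`, `e₂`, `e₁ + e₂`, `e₃`. -/
def Admissible (v : Fin 3 → ℤ) : Prop :=
  v 2 % 2 = 0 ∧ (v 0 % 2 = 1 ∨ v 1 % 2 = 1) ∨ v 2 % 2 = 1 ∧ v 0 % 2 = 0 ∧ v 1 % 2 = 0

theorem det_eq_tripleDet (b : Fin 3 → Fin 3 → ℤ) :
    (Pi.basisFun ℤ (Fin 3)).det b = tripleDet (b 0) (b 1) (b 2) := by
  rw [Pi.basisFun_det_apply, Matrix.det_fin_three, tripleDet]
  simp only [Matrix.of_apply]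
  ring

theorem exists_basis_of_isUnit {x y z : Fin 3 → ℤ} (h : IsUnit (tripleDet x y z)) :
    ∃ b : Module.Basis (Fin 3) ℤ (Fin 3 → ℤ), b 0 = x ∧ b 1 = y ∧ b 2 = z := by
  have h' : IsUnit ((Pi.basisFun ℤ (Fin 3)).det ![x, y, z]) := by
    rw [det_eq_tripleDet]; exact h
  obtain ⟨hli, hsp⟩ := (Module.Basis.is_basis_iff_det _).2 h'
  exact ⟨.mk hli hsp.ge, by simp, by simp, by simp⟩

theorem isUnit_tripleDet (b : Module.Basis (Fin 3) ℤ (Fin 3 → ℤ)) :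
    IsUnit (tripleDet (b 0) (b 1) (b 2)) := by
  rw [← det_eq_tripleDet]
  exact (Module.Basis.is_basis_iff_det _).1 ⟨b.linearIndependent, b.span_eq⟩

theorem exists_isUnit_of_ne {b : Module.Basis (Fin 3) ℤ (Fin 3 → ℤ)} {x y : Fin 3 → ℤ}
    (hx : x ∈ Set.range b) (hy : y ∈ Set.range b) (hxy : x ≠ y) :
    ∃ z, IsUnit (tripleDet x y z) := by
  obtain ⟨i, rfl⟩ := hx
  obtain ⟨j, rfl⟩ := hy
  have hperm : ∀ i j : Fin 3, i ≠ j → ∃ e : Equiv.Perm (Fin 3), e 0 = i ∧ e 1 = j := by decide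
  obtain ⟨e, rfl, rfl⟩ := hperm i j fun h => hxy (h ▸ rfl)
  exact ⟨b (e 2), by simpa using isUnit_tripleDet (b.reindex e.symm)⟩

theorem exists_isUnit {b : Module.Basis (Fin 3) ℤ (Fin 3 → ℤ)} {x : Fin 3 → ℤ}
    (hx : x ∈ Set.range b) : ∃ y z, IsUnit (tripleDet x y z) := by
  obtain ⟨i, rfl⟩ := hx
  obtain ⟨j, hij⟩ := exists_ne i
  exact ⟨b j, exists_isUnit_of_ne ⟨i, rfl⟩ ⟨j, rfl⟩ (b.injective.ne hij.symm)⟩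

theorem mem_partialBasisComplex {x y z : Fin 3 → ℤ} (h : IsUnit (tripleDet x y z)) :
    {x, y, z} ∈ (partialBasisComplex 3).faces := by
  obtain ⟨b, rfl, rfl, rfl⟩ := exists_basis_of_isUnit h
  refine ⟨by simp, b, ?_⟩
  simp [Set.insert_subset_iff]

theorem tripleDet_swap (x y z : Fin 3 → ℤ) : tripleDet y x z = -tripleDet x y z := by
  unfold tripleDet; ring

theorem tripleDet_rotate (x y z : Fin 3 → ℤ) : tripleDet y z x = tripleDet x y z := by
  unfold tripleDet; ring

theorem isUnit_swap {x y z : Fin 3 → ℤ} (h : IsUnit (tripleDet x y z)) :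
    IsUnit (tripleDet y x z) := by
  rw [tripleDet_swap]; exact h.neg

theorem isUnit_rotate {x y z : Fin 3 → ℤ} (h : IsUnit (tripleDet x y z)) :
    IsUnit (tripleDet y z x) := by
  rwa [tripleDet_rotate]

/-- Cramer's rule for a basis of `ℤ³`. -/
theorem exists_coords {v y z : Fin 3 → ℤ} (h : IsUnit (tripleDet v y z)) (u : Fin 3 → ℤ) :
    ∃ α a b : ℤ, u = α • v + a • y + b • z := by
  have hsq : tripleDet v y z * tripleDet v y z = 1 := Int.isUnit_mul_self h
  refine ⟨tripleDet v y z * tripleDet u y z, tripleDet v y z * tripleDet v u z,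
    tripleDet v y z * tripleDet v y u, ?_⟩
  have key : ∀ i, tripleDet v y z * u i =
      tripleDet u y z * v i + tripleDet v u z * y i + tripleDet v y u * z i := by
    intro i
    fin_cases i <;> simp only [tripleDet, Fin.zero_eta, Fin.mk_one, Fin.reduceFinMk] <;> ring
  ext i
  simp only [Pi.add_apply, Pi.smul_apply, smul_eq_mul]
  linear_combination tripleDet v y z * key i - u i * hsq

/-- A vector of a basis of `ℤ³` can be completed to a basis whose other two members have any
prescribed reductions modulo `2` that are not excluded by the determinant. -/
theorem exists_completion {v y z : Fin 3 → ℤ} (h : IsUnit (tripleDet v y z)) (y₀ z₀ : Fin 3 → ℤ)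
    (h₀ : tripleDet v y₀ z₀ % 2 = 1) :
    ∃ y' z', IsUnit (tripleDet v y' z') ∧ (∀ i, y' i % 2 = y₀ i % 2) ∧
      ∀ i, z' i % 2 = z₀ i % 2 := by
  obtain ⟨α, a, b, hy⟩ := exists_coords h y₀
  obtain ⟨β, c, d, hz⟩ := exists_coords h z₀
  have hparity : ∀ (p q r : ℤ) (i : Fin 3),
      ((p % 2) • v + (q % 2) • y + (r % 2) • z) i % 2 = (p • v + q • y + r • z) i % 2 := by
    intro p q r i
    simp only [Pi.add_apply, Pi.smul_apply, smul_eq_mul]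
    rw [Int.emod_def p, Int.emod_def q, Int.emod_def r, Int.emod_emod_of_dvd _ dvd_rfl |>.symm]
    refine Int.emod_emod_of_dvd _ dvd_rfl |>.trans (Int.emod_emod_of_dvd _ dvd_rfl).symm |>.trans ?_
    refine (Int.emod_emod_of_dvd _ dvd_rfl).trans (Int.ModEq.symm (Int.modEq_iff_dvd.2 ?_))
    exact ⟨-(p / 2 * v i + q / 2 * y i + r / 2 * z i), by ring⟩
  have hdet : ∀ p q r s t w : ℤ, tripleDet v (p • v + q • y + r • z) (s • v + t • y + w • z) =
      (q * w - r * t) * tripleDet v y z := by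
    intro p q r s t w
    simp only [tripleDet, Pi.add_apply, Pi.smul_apply, smul_eq_mul]
    ring
  -- Reducing the coefficients to 0 or 1 preserves parities, and a 2 × 2 matrix with entries 0 and 1
  -- and odd determinant has determinant ±1.
  refine ⟨(α % 2) • v + (a % 2) • y + (b % 2) • z, (β % 2) • v + (c % 2) • y + (d % 2) • z,
    ?_, fun i => by rw [hparity, hy], fun i => by rw [hparity, hz]⟩
  rw [hy, hz, hdet] at h₀
  rw [hdet]
  refine IsUnit.mul ?_ h
  have hodd : (a * d - b * c) % 2 = 1 := by
    rw [← Int.odd_iff] at h₀ ⊢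
    exact (Int.odd_mul.1 h₀).1
  rw [Int.isUnit_iff]
  rcases Int.emod_two_eq a with ha | ha <;> rcases Int.emod_two_eq b with hb | hb <;>
    rcases Int.emod_two_eq c with hc | hc <;> rcases Int.emod_two_eq d with hd | hd <;>
    simp [Int.sub_emod, Int.mul_emod, ha, hb, hc, hd] at hodd ⊢

/-! ### The vertices and faces of the augmented complex, by parity. -/

/-- The columns of a matrix in `Γ₃[2]` are vertices of the complex of partial `π`-bases. -/
theorem mem_vertexSet_of_columns (c : Fin 3 → Fin 3 → ℤ)
    (h : IsUnit (tripleDet (c 0) (c 1) (c 2)))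
    (hc : ∀ j i, c j i % 2 = (1 : Matrix (Fin 3) (Fin 3) ℤ) i j) (j : Fin 3) :
    c j ∈ (partialPiBasisComplex 3).vertexSet := by
  have hdet : IsUnit (Matrix.of fun i j => c j i).det := by
    rw [← Matrix.det_transpose]
    have := det_eq_tripleDet c
    rw [Pi.basisFun_det_apply] at this
    exact this ▸ h
  obtain ⟨M, hM⟩ := (Matrix.isUnit_iff_isUnit_det _).2 hdet
  refine ⟨by simp, _, ⟨M, ?_, rfl⟩, ?_⟩
  · rw [levelTwo, MonoidHom.mem_ker]
    ext i k
    have key : ((c k i : ℤ) : ZMod 2) = (1 : Matrix (Fin 3) (Fin 3) (ZMod 2)) i k := by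
      rw [← ZMod.intCast_mod, Nat.cast_ofNat, hc k i, Matrix.one_apply, Matrix.one_apply]
      split_ifs <;> simp
    simpa [hM] using key
  · rw [Finset.coe_singleton, Set.singleton_subset_iff]
    exact ⟨j, by ext i; simp [hM]⟩

theorem admissible_of_mem_vertexSet {v : Fin 3 → ℤ}
    (h : v ∈ (partialPiBasisComplex 3).vertexSet) : Admissible v := by
  obtain ⟨_, B, ⟨M, hM, rfl⟩, hv⟩ := h
  rw [Finset.coe_singleton, Set.singleton_subset_iff] at hv
  obtain ⟨j, rfl⟩ := hv
  rw [levelTwo, MonoidHom.mem_ker] at hM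
  have key : ∀ i, ((M.1 i j : ℤ) : ZMod 2) = (1 : Matrix (Fin 3) (Fin 3) (ZMod 2)) i j := by
    intro i
    have := congrArg (fun N : Matrix.GeneralLinearGroup (Fin 3) (ZMod 2) => N.1 i j) hM
    simpa using this
  have h0 : ∀ n : ℤ, (n : ZMod 2) = 0 → n % 2 = 0 := fun n hn =>
    Int.emod_eq_zero_of_dvd ((ZMod.intCast_zmod_eq_zero_iff_dvd n 2).1 hn)
  have h1 : ∀ n : ℤ, (n : ZMod 2) = 1 → n % 2 = 1 := fun n hn => by
    have := (ZMod.intCast_eq_intCast_iff' n 1 2).1 (by simpa using hn)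
    simpa using this
  simp only [Admissible, Matrix.mulVec_single_one, Matrix.col_apply]
  have k0 := key 0
  have k1 := key 1
  have k2 := key 2
  fin_cases j <;> simp [Matrix.one_apply] at k0 k1 k2 ⊢ <;> simp_all

/-- If $v$ reduces to some $e_j$, it can be completed to a basis whose other members reduce to the
remaining standard vectors, that is, to the columns of a matrix in $\Gamma_3[2]$. The class
$e_1+e_2$ is the augmentation. -/
theorem mem_vertexSet_or_of_admissible {v : Fin 3 → ℤ} (hv : Admissible v)
    (h : ∃ y z, IsUnit (tripleDet v y z)) :
    v ∈ (partialPiBasisComplex 3).vertexSet ∪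
      {u | u ∈ (partialBasisComplex 3).vertexSet ∧ Odd (u 0) ∧ Odd (u 1) ∧ Even (u 2)} := by
  obtain ⟨y, z, h⟩ := h
  by_cases h2 : v 2 % 2 = 0
  · by_cases h0 : v 0 % 2 = 1
    · by_cases h1 : v 1 % 2 = 1
      · right
        refine ⟨?_, Int.odd_iff.2 h0, Int.odd_iff.2 h1, Int.even_iff.2 h2⟩
        exact PreAbstractSimplicialComplex.mem_faces_of_subset _ (mem_partialBasisComplex h)
          (by simp) (by simp)
      · left
        obtain ⟨y', z', hu, hy, hz⟩ := exists_completion h ![0, 1, 0] ![0, 0, 1]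
          (by simpa [tripleDet] using h0)
        exact mem_vertexSet_of_columns ![v, y', z'] hu (fun
          | 0 => fun i => by fin_cases i; exacts [h0, by simpa using h1, h2]
          | 1 => fun i => (hy i).trans (by revert i; decide)
          | 2 => fun i => (hz i).trans (by revert i; decide)) 0
    · left
      have h1 : v 1 % 2 = 1 := by unfold Admissible at hv; omega
      obtain ⟨y', z', hu, hy, hz⟩ := exists_completion h ![1, 0, 0] ![0, 0, 1]
        (by simp [tripleDet]; omega)
      exact mem_vertexSet_of_columns ![y', v, z'] (isUnit_swap hu) (fun
          | 0 => fun i => (hy i).trans (by revert i; decide)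
          | 1 => fun i => by fin_cases i; exacts [by simpa using h0, h1, h2]
          | 2 => fun i => (hz i).trans (by revert i; decide)) 1
  · left
    have h01 : v 2 % 2 = 1 ∧ v 0 % 2 = 0 ∧ v 1 % 2 = 0 := by unfold Admissible at hv; omega
    obtain ⟨y', z', hu, hy, hz⟩ := exists_completion h ![1, 0, 0] ![0, 1, 0]
      (by simp [tripleDet]; omega)
    exact mem_vertexSet_of_columns ![y', z', v] (isUnit_rotate hu) (fun
          | 0 => fun i => (hy i).trans (by revert i; decide)
          | 1 => fun i => (hz i).trans (by revert i; decide)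
          | 2 => fun i => by fin_cases i; exacts [h01.2.1, h01.2.2, h01.1]) 2

open PreAbstractSimplicialComplex

theorem mem_augmentedComplex {x y z : Fin 3 → ℤ} (hx : Admissible x) (hy : Admissible y)
    (hz : Admissible z) (h : IsUnit (tripleDet x y z)) : {x, y, z} ∈ augmentedComplex.faces := by
  refine ⟨mem_partialBasisComplex h, ?_⟩
  simp only [Finset.coe_insert, Finset.coe_singleton, Set.insert_subset_iff,
    Set.singleton_subset_iff]
  exact ⟨mem_vertexSet_or_of_admissible hx ⟨_, _, h⟩,
    mem_vertexSet_or_of_admissible hy ⟨_, _, isUnit_rotate h⟩,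
    mem_vertexSet_or_of_admissible hz ⟨_, _, isUnit_rotate (isUnit_rotate h)⟩⟩

theorem pair_mem_augmentedComplex {x y z : Fin 3 → ℤ} (hx : Admissible x) (hy : Admissible y)
    (h : IsUnit (tripleDet x y z)) : {x, y} ∈ augmentedComplex.faces := by
  refine ⟨pair_mem_faces₁₂ (mem_partialBasisComplex h), ?_⟩
  simp only [Finset.coe_insert, Finset.coe_singleton, Set.insert_subset_iff,
    Set.singleton_subset_iff]
  exact ⟨mem_vertexSet_or_of_admissible hx ⟨_, _, h⟩,
    mem_vertexSet_or_of_admissible hy ⟨_, _, isUnit_rotate h⟩⟩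

theorem admissible_of_mem {s : Finset (Fin 3 → ℤ)} (hs : s ∈ augmentedComplex.faces)
    {x : Fin 3 → ℤ} (hx : x ∈ s) : Admissible x := by
  rcases hs.2 hx with h | ⟨_, h0, h1, h2⟩
  · exact admissible_of_mem_vertexSet h
  · rw [Int.odd_iff] at h0 h1
    rw [Int.even_iff] at h2
    exact Or.inl ⟨h2, Or.inl h0⟩

theorem exists_isUnit_of_mem {x : Fin 3 → ℤ} (h : {x} ∈ augmentedComplex.faces) :
    ∃ y z, IsUnit (tripleDet x y z) := by
  obtain ⟨⟨_, b, hb⟩, _⟩ := h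
  exact exists_isUnit (hb (by simp))

theorem exists_isUnit_of_pair_mem {x y : Fin 3 → ℤ} (h : {x, y} ∈ augmentedComplex.faces)
    (hxy : x ≠ y) : ∃ z, IsUnit (tripleDet x y z) := by
  obtain ⟨⟨_, b, hb⟩, _⟩ := h
  exact exists_isUnit_of_ne (hb (by simp)) (hb (by simp)) hxy

theorem admissible_e₃ : Admissible ![0, 0, 1] := by simp [Admissible]

/-! ### Division with remainder under parity constraints. -/

theorem natAbs_lt_of_abs_lt {m n : ℤ} (h : |m| < |n|) : m.natAbs < n.natAbs := by
  rw [Int.abs_eq_natAbs, Int.abs_eq_natAbs] at h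
  exact_mod_cast h

theorem exists_abs_add_mul_lt (m : ℤ) {n : ℤ} (hn : n ≠ 0) : ∃ q, |q * n + m| < |n| := by
  refine ⟨-(m / n), ?_⟩
  have h1 := Int.emod_nonneg m hn
  have h2 := Int.emod_lt_abs m hn
  have h3 : -(m / n) * n + m = m % n := by rw [Int.emod_def]; ring
  rwa [h3, abs_of_nonneg h1]

/-- Even multiples of $n$ bring $m$ into the range from $-|n|$ to $|n|$; the endpoints are excluded
because they have the parity of $n$ and $m$ does not. -/
theorem exists_abs_add_two_mul_lt {m n : ℤ} (h : (m + n) % 2 = 1) (hn : n ≠ 0) :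
    ∃ q, |2 * q * n + m| < |n| := by
  have h2n : 2 * n ≠ 0 := by omega
  have h1 := Int.emod_nonneg m h2n
  have h2 := Int.emod_lt_abs m h2n
  have h3 : 2 * n * (m / (2 * n)) + m % (2 * n) = m := Int.mul_ediv_add_emod m (2 * n)
  have h4 : m % (2 * n) % 2 = m % 2 := Int.emod_emod_of_dvd m ⟨n, rfl⟩
  set r := m % (2 * n)
  set k := m / (2 * n)
  rw [abs_mul, abs_two] at h2
  rcases lt_or_ge r |n| with hr | hr
  · refine ⟨-k, ?_⟩
    rw [show 2 * -k * n + m = r by linear_combination -h3, abs_of_nonneg h1]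
    exact hr
  · rcases abs_cases n with ⟨hn', _⟩ | ⟨hn', _⟩
    · refine ⟨-k - 1, ?_⟩
      rw [show 2 * (-k - 1) * n + m = r - 2 * n by linear_combination -h3, abs_lt]
      omega
    · refine ⟨-k + 1, ?_⟩
      rw [show 2 * (-k + 1) * n + m = r + 2 * n by linear_combination -h3, abs_lt]
      omega

theorem exists_det_eq_one {a b : ℤ} (h : IsCoprime a b) (hb : b ≠ 0) :
    ∃ c d : ℤ, a * d - b * c = 1 ∧ 0 ≤ d ∧ d < |b| := by
  obtain ⟨u, w, huw⟩ := h
  refine ⟨-w - a * (u / b), u % b, ?_, Int.emod_nonneg _ hb, Int.emod_lt_abs _ hb⟩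
  rw [Int.emod_def]
  linear_combination huw

/-- If the Bézout pair $(c,d)$ has even sum, adding or subtracting $(a,b)$ corrects the parity
without changing the determinant. The bound on the second entry survives unless $d=0$, which forces
$b=\pm1$, a case treated directly. -/
theorem exists_det_isUnit_of_odd {a b : ℤ} (h : IsCoprime a b) (hab : (a + b) % 2 = 1)
    (hb : b ≠ 0) : ∃ c d : ℤ, (c + d) % 2 = 1 ∧ |d| < |b| ∧ IsUnit (a * d - b * c) := by
  by_cases hb1 : IsUnit b
  · exact ⟨1, 0, rfl, by simpa using hb, by simpa using hb1⟩
  obtain ⟨c, d, h1, h2, h3⟩ := exists_det_eq_one h hb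
  by_cases hcd : (c + d) % 2 = 1
  · exact ⟨c, d, hcd, by rwa [abs_of_nonneg h2], by rw [h1]; exact isUnit_one⟩
  have hd : d ≠ 0 := by
    rintro rfl
    exact hb1 (IsUnit.of_mul_eq_one (-c) (by linear_combination h1))
  rcases abs_cases b with ⟨hb', _⟩ | ⟨hb', _⟩
  · refine ⟨c - a, d - b, by omega, by rw [abs_lt]; omega, ?_⟩
    rw [show a * (d - b) - b * (c - a) = 1 by linear_combination h1]
    exact isUnit_one
  · refine ⟨c + a, d + b, by omega, by rw [abs_lt]; omega, ?_⟩
    rw [show a * (d + b) - b * (c + a) = 1 by linear_combination h1]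
    exact isUnit_one

/-! ### Descending links. -/

/-- Adjacency in the link of $v$ depends only on the images in $\mathbb Z^3/v$, so the lifts may be
chosen freely. -/
theorem tripleDet_comb (v y z : Fin 3 → ℤ) (α a b β c d : ℤ) :
    tripleDet v (α • v + a • y + b • z) (β • v + c • y + d • z) =
      (a * d - b * c) * tripleDet v y z := by
  simp only [tripleDet, Pi.add_apply, Pi.smul_apply, smul_eq_mul]
  ring

/-- The descending link of `v` is connected if, in coordinates with respect to a basis containing
`v`, its image in `ℤ³ / v` is closed under a Euclidean algorithm. -/
theorem descending_link_connected {v y z : Fin 3 → ℤ} (h : IsUnit (tripleDet v y z))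
    (hv : Admissible v) (P : ℤ → ℤ → Prop) (h01 : P 0 1)
    (hP : ∀ α a b : ℤ, Admissible (α • v + a • y + b • z) → IsCoprime a b → P a b)
    (hlift : ∀ a b, P a b → IsCoprime a b → ∃ α : ℤ, Admissible (α • v + a • y + b • z) ∧
      |(α • v + a • y + b • z) 2| < |v 2|)
    (hdesc : ∀ a b, P a b → IsCoprime a b → b ≠ 0 →
      ∃ c d, P c d ∧ |d| < |b| ∧ IsUnit (a * d - b * c)) :
    ∃ u₀, (u₀ 2).natAbs < (v 2).natAbs ∧ {u₀, v} ∈ augmentedComplex.faces ∧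
      ∀ u, {u, v} ∈ augmentedComplex.faces → (u 2).natAbs < (v 2).natAbs →
        Relation.ReflTransGen (fun x y => (x 2).natAbs < (v 2).natAbs ∧
          (y 2).natAbs < (v 2).natAbs ∧ {x, y, v} ∈ augmentedComplex.faces) u u₀ := by
  obtain ⟨β, hadm₀, hlt₀⟩ := hlift 0 1 h01 isCoprime_one_right
  have hface : ∀ α a b β c d : ℤ, Admissible (α • v + a • y + b • z) →
      Admissible (β • v + c • y + d • z) → IsUnit (a * d - b * c) →
      {α • v + a • y + b • z, β • v + c • y + d • z, v} ∈ augmentedComplex.faces := by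
    intro α a b β c d h1 h2 h3
    refine mem_augmentedComplex h1 h2 hv (isUnit_rotate ?_)
    rw [tripleDet_comb]
    exact h3.mul h
  have key : ∀ n : ℕ, ∀ α a b : ℤ, b.natAbs = n → IsCoprime a b →
      Admissible (α • v + a • y + b • z) →
      ((α • v + a • y + b • z) 2).natAbs < (v 2).natAbs →
      Relation.ReflTransGen (fun x y => (x 2).natAbs < (v 2).natAbs ∧
          (y 2).natAbs < (v 2).natAbs ∧ {x, y, v} ∈ augmentedComplex.faces)
        (α • v + a • y + b • z) (β • v + (0 : ℤ) • y + (1 : ℤ) • z) := by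
    intro n
    induction n using Nat.strong_induction_on with
    | _ n ih =>
      intro α a b hn hab hadm hlt
      -- A coprime pair with `b = 0` is $(\pm1,0)$, adjacent to the base vertex $(0,1)$; otherwise
      -- one Euclidean step lowers `|b|`.
      by_cases hb : b = 0
      · refine Relation.ReflTransGen.single
          ⟨hlt, natAbs_lt_of_abs_lt hlt₀, hface _ _ _ _ _ _ hadm hadm₀ ?_⟩
        subst hb
        simpa using isCoprime_zero_right.1 hab
      · obtain ⟨c, d, hPcd, hd, hunit⟩ := hdesc a b (hP _ _ _ hadm hab) hab hb
        have hcd : IsCoprime c d := by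
          obtain ⟨w, hw⟩ := hunit.exists_left_inv
          exact ⟨-(w * b), w * a, by linear_combination hw⟩
        obtain ⟨γ, hγ, hγlt⟩ := hlift c d hPcd hcd
        have hγlt' := natAbs_lt_of_abs_lt hγlt
        exact Relation.ReflTransGen.head ⟨hlt, hγlt', hface _ _ _ _ _ _ hadm hγ hunit⟩
          (ih _ (hn ▸ natAbs_lt_of_abs_lt hd) γ c d rfl hcd hγ hγlt')
  refine ⟨β • v + (0 : ℤ) • y + (1 : ℤ) • z, natAbs_lt_of_abs_lt hlt₀, ?_,
    fun u hu hlt => ?_⟩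
  · refine pair_mem_augmentedComplex (z := y) hadm₀ hv (isUnit_swap ?_)
    have := tripleDet_comb v y z β 0 1 0 1 0
    simp only [zero_smul, one_smul, zero_add, add_zero] at this ⊢
    rw [this]
    exact IsUnit.mul (by simp) h
  · have hne : u ≠ v := by
      rintro rfl
      exact lt_irrefl _ hlt
    obtain ⟨t, ht⟩ := exists_isUnit_of_pair_mem hu hne
    have hadm := admissible_of_mem hu (x := u) (by simp)
    obtain ⟨α, a, b, rfl⟩ := exists_coords h u
    obtain ⟨γ, c, d, rfl⟩ := exists_coords h t
    have ht' := isUnit_swap ht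
    rw [tripleDet_comb] at ht'
    obtain ⟨w, hw⟩ := (isUnit_of_mul_isUnit_left ht').exists_left_inv
    exact key _ α a b rfl ⟨w * d, -(w * c), by linear_combination hw⟩ hadm hlt

theorem descending_link {v : Fin 3 → ℤ} (hv : {v} ∈ augmentedComplex.faces)
    (h2 : 0 < (v 2).natAbs) :
    ∃ u₀, (u₀ 2).natAbs < (v 2).natAbs ∧ {u₀, v} ∈ augmentedComplex.faces ∧
      ∀ u, {u, v} ∈ augmentedComplex.faces → (u 2).natAbs < (v 2).natAbs →
        Relation.ReflTransGen (fun x y => (x 2).natAbs < (v 2).natAbs ∧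
          (y 2).natAbs < (v 2).natAbs ∧ {x, y, v} ∈ augmentedComplex.faces) u u₀ := by
  have hadm := admissible_of_mem hv (x := v) (by simp)
  obtain ⟨y₀, z₀, h⟩ := exists_isUnit_of_mem hv
  have hv2 : v 2 ≠ 0 := by omega
  rcases hadm with ⟨hev, hor⟩ | ⟨hodd, hv0, hv1⟩
  -- Here `z` reduces to $e_3$ and `y` to $e_2$ or $e_1$, whichever is chosen independent of `v` mod
  -- 2.
  · obtain ⟨y, z, hu, ⟨hy2, hyv⟩, hz0, hz1, hz2⟩ : ∃ y z, IsUnit (tripleDet v y z) ∧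
        (y 2 % 2 = 0 ∧ (y 0 % 2 = 0 ∧ y 1 % 2 = 1 ∧ v 0 % 2 = 1 ∨
          y 0 % 2 = 1 ∧ y 1 % 2 = 0 ∧ v 0 % 2 = 0 ∧ v 1 % 2 = 1)) ∧
        z 0 % 2 = 0 ∧ z 1 % 2 = 0 ∧ z 2 % 2 = 1 := by
      by_cases hv0 : v 0 % 2 = 1
      · obtain ⟨y, z, hu, hy, hz⟩ := exists_completion h ![0, 1, 0] ![0, 0, 1]
          (by simpa [tripleDet] using hv0)
        exact ⟨y, z, hu, ⟨hy 2, Or.inl ⟨hy 0, hy 1, hv0⟩⟩, hz 0, hz 1, hz 2⟩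
      · obtain ⟨y, z, hu, hy, hz⟩ := exists_completion h ![1, 0, 0] ![0, 0, 1]
          (by simp [tripleDet]; omega)
        exact ⟨y, z, hu, ⟨hy 2, Or.inr ⟨hy 0, hy 1, by omega, by omega⟩⟩, hz 0, hz 1, hz 2⟩
    have hmod : ∀ (α a b : ℤ) i, (α • v + a • y + b • z) i % 2 =
        ((α % 2) * (v i % 2) + (a % 2) * (y i % 2) + (b % 2) * (z i % 2)) % 2 := by
      intro α a b i
      simp [Int.add_emod, Int.mul_emod]
    -- For $(a,b)$ mod 2: the class $(1,0)$ allows every `α`, $(0,1)$ needs `α` even, and $(1,1)$ is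
    -- never admissible.
    have hiff : ∀ α a b : ℤ, ¬(a % 2 = 0 ∧ b % 2 = 0) →
        (Admissible (α • v + a • y + b • z) ↔ (a + b) % 2 = 1 ∧ (b % 2 = 0 ∨ α % 2 = 0)) := by
      intro α a b hab
      unfold Admissible
      rw [hmod, hmod, hmod, hev, hy2, hz0, hz1, hz2]
      rcases Int.emod_two_eq α with h1 | h1 <;> rcases Int.emod_two_eq a with h2 | h2 <;>
        rcases Int.emod_two_eq b with h3 | h3 <;>
          simp only [h1, h2, h3, or_true, true_or, and_true] <;> omega
    have hcop : ∀ a b : ℤ, IsCoprime a b → ¬(a % 2 = 0 ∧ b % 2 = 0) := by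
      rintro a b ⟨u, w, huw⟩ ⟨ha, hb⟩
      have : (u * a + w * b) % 2 = 0 := by simp [Int.add_emod, Int.mul_emod, ha, hb]
      omega
    refine descending_link_connected hu (Or.inl ⟨hev, hor⟩) (fun a b => (a + b) % 2 = 1) rfl
      ?_ ?_ ?_
    · exact fun α a b h1 h2 => ((hiff α a b (hcop a b h2)).1 h1).1
    · intro a b hab hco
      have hthird : ∀ α : ℤ, (α • v + a • y + b • z) 2 = α * v 2 + (a * y 2 + b * z 2) := by
        intro α
        simp [add_assoc]
      -- For `b` even ordinary division suffices. For `b` odd only even multiples of `v` are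
      -- allowed, but the third coordinate is then odd while `v 2` is even.
      rcases Int.emod_two_eq b with hb | hb
      · obtain ⟨q, hq⟩ := exists_abs_add_mul_lt (a * y 2 + b * z 2) hv2
        exact ⟨q, (hiff _ _ _ (hcop a b hco)).2 ⟨hab, by omega⟩, by rwa [hthird]⟩
      · obtain ⟨q, hq⟩ := exists_abs_add_two_mul_lt (m := a * y 2 + b * z 2) (n := v 2)
          (by simp [Int.add_emod, Int.mul_emod, hb, hy2, hz2, hev]) hv2
        exact ⟨2 * q, (hiff _ _ _ (hcop a b hco)).2 ⟨hab, by omega⟩, by rwa [hthird]⟩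
    · exact fun a b hab hco hb => exists_det_isUnit_of_odd hco hab hb
  · obtain ⟨y, z, hu, hy, hz⟩ := exists_completion h ![1, 0, 0] ![0, 1, 0]
      (by simpa [tripleDet] using hodd)
    have hy0 : y 0 % 2 = 1 := hy 0
    have hy1 : y 1 % 2 = 0 := hy 1
    have hy2 : y 2 % 2 = 0 := hy 2
    have hz0 : z 0 % 2 = 0 := hz 0
    have hz1 : z 1 % 2 = 1 := hz 1
    have hz2 : z 2 % 2 = 0 := hz 2
    -- Now `v` reduces to $e_3$: every primitive class $(a,b)$ is admissible with `α` even, so no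
    -- parity constraint enters the Euclidean algorithm.
    refine descending_link_connected hu (Or.inr ⟨hodd, hv0, hv1⟩) (fun _ _ => True) trivial
      (fun _ _ _ _ _ => trivial) ?_ ?_
    · intro a b _ hco
      obtain ⟨q, hq⟩ := exists_abs_add_two_mul_lt (m := a * y 2 + b * z 2) (n := v 2)
        (by simp [Int.add_emod, Int.mul_emod, hy2, hz2, hodd]) hv2
      refine ⟨2 * q, ?_, by simpa [add_assoc] using hq⟩
      have hcop : a % 2 = 1 ∨ b % 2 = 1 := by
        by_contra! hcon
        obtain ⟨u, w, huw⟩ := hco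
        have ha : a % 2 = 0 := by omega
        have hb : b % 2 = 0 := by omega
        have : (u * a + w * b) % 2 = 0 := by simp [Int.add_emod, Int.mul_emod, ha, hb]
        omega
      left
      constructor
      · simp [Int.add_emod, Int.mul_emod, hy2, hz2]
      · simpa [Int.add_emod, Int.mul_emod, hy0, hz0, hy1, hz1] using hcop
    · intro a b _ hco hb
      obtain ⟨c, d, h1, h2, h3⟩ := exists_det_eq_one hco hb
      exact ⟨c, d, trivial, by rwa [abs_of_nonneg h2], by rw [h1]; exact isUnit_one⟩

/-! ### The cone at height zero and horizontal edges. -/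

theorem cone_mem {x y : Fin 3 → ℤ} (h : {x, y} ∈ augmentedComplex.faces)
    (hx : (x 2).natAbs = 0) (hy : (y 2).natAbs = 0) :
    {![0, 0, 1], x, y} ∈ augmentedComplex.faces := by
  have hadmx := admissible_of_mem h (x := x) (by simp)
  have hadmy := admissible_of_mem h (x := y) (by simp)
  rw [Int.natAbs_eq_zero] at hx hy
  rcases eq_or_ne x y with rfl | hne
  · obtain ⟨p, q, hpq⟩ := exists_isUnit_of_mem (left_mem_faces h)
    obtain ⟨w, hw⟩ := hpq.exists_left_inv
    rw [Finset.pair_eq_singleton]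
    -- As `x 2 = 0`, expanding the determinant of `x, p, q` along `x` is a Bézout relation for `x 0`
    -- and `x 1`; its coefficients give the third basis vector.
    refine pair_mem_augmentedComplex (z := ![w * (p 2 * q 0 - p 0 * q 2),
      w * (p 2 * q 1 - p 1 * q 2), 0]) admissible_e₃ hadmx ?_
    have : tripleDet ![0, 0, 1] x ![w * (p 2 * q 0 - p 0 * q 2),
        w * (p 2 * q 1 - p 1 * q 2), 0] = -1 := by
      simp [tripleDet, hx] at hw ⊢
      linear_combination -hw
    rw [this]
    exact isUnit_one.neg
  · obtain ⟨z, hz⟩ := exists_isUnit_of_pair_mem h hne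
    refine mem_augmentedComplex admissible_e₃ hadmx hadmy ?_
    have : tripleDet x y z = z 2 * tripleDet ![0, 0, 1] x y := by
      simp [tripleDet, hx, hy]
      ring
    rw [this] at hz
    exact isUnit_of_mul_isUnit_right hz

/-- Complete $u,v$ to a basis by a vector reducing to $e_3$. Its third coordinate is odd and that of
$v$ is even, so an even multiple of $v$ brings it strictly below $v$. -/
theorem exists_lower_of_horizontal {u v : Fin 3 → ℤ} (hne : u ≠ v)
    (h : {u, v} ∈ augmentedComplex.faces) (heq : (u 2).natAbs = (v 2).natAbs)
    (hpos : 0 < (v 2).natAbs) :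
    ∃ w, (w 2).natAbs < (v 2).natAbs ∧ {u, v, w} ∈ augmentedComplex.faces := by
  have hadmu := admissible_of_mem h (x := u) (by simp)
  have hadmv := admissible_of_mem h (x := v) (by simp)
  obtain ⟨t, ht⟩ := exists_isUnit_of_pair_mem h hne
  have hodd : tripleDet u v t % 2 = 1 := by
    rcases Int.isUnit_iff.1 ht with h | h <;> rw [h] <;> rfl
  have hmod : tripleDet u v t % 2 = tripleDet (fun i => u i % 2) (fun i => v i % 2)
      (fun i => t i % 2) % 2 := by
    simp [tripleDet, Int.add_emod, Int.sub_emod, Int.mul_emod]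
  rw [hmod] at hodd
  -- Equal heights have equal parity, and if both were odd then `u` and `v` would both reduce to
  -- $e_3$, contradicting independence mod 2.
  have hpar : u 2 % 2 = 0 ∧ v 2 % 2 = 0 := by
    by_contra hcon
    have hu : u 2 % 2 = 1 ∧ v 2 % 2 = 1 := by omega
    have hu' : u 0 % 2 = 0 ∧ u 1 % 2 = 0 := by unfold Admissible at hadmu; omega
    have hv' : v 0 % 2 = 0 ∧ v 1 % 2 = 0 := by unfold Admissible at hadmv; omega
    simp [tripleDet, hu, hu', hv'] at hodd
  have hex : ∃ β γ : ℤ, (t 0 + β * u 0 + γ * v 0) % 2 = 0 ∧ (t 1 + β * u 1 + γ * v 1) % 2 = 0 ∧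
      t 2 % 2 = 1 := by
    simp only [tripleDet, hpar] at hodd
    -- Cramer's rule mod 2 in the first two coordinates, where the minor of `u, v` is odd.
    refine ⟨(t 0 % 2) * (v 1 % 2) - (t 1 % 2) * (v 0 % 2),
      (u 0 % 2) * (t 1 % 2) - (u 1 % 2) * (t 0 % 2), ?_, ?_, ?_⟩ <;>
    rcases Int.emod_two_eq (u 0) with h1 | h1 <;> rcases Int.emod_two_eq (u 1) with h2 | h2 <;>
    rcases Int.emod_two_eq (v 0) with h3 | h3 <;> rcases Int.emod_two_eq (v 1) with h4 | h4 <;>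
    rcases Int.emod_two_eq (t 0) with h5 | h5 <;> rcases Int.emod_two_eq (t 1) with h6 | h6 <;>
    simp only [h1, h2, h3, h4, h5, h6] at hodd ⊢ <;> omega
  obtain ⟨β, γ, h0, h1, h2⟩ := hex
  have hm : (t 2 + β * u 2 + γ * v 2 + v 2) % 2 = 1 := by
    simp [Int.add_emod, Int.mul_emod, hpar, h2]
  obtain ⟨q, hq⟩ := exists_abs_add_two_mul_lt hm (by omega)
  refine ⟨t + β • u + (γ + 2 * q) • v, ?_, mem_augmentedComplex hadmu hadmv (Or.inr ?_) ?_⟩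
  · apply natAbs_lt_of_abs_lt
    convert hq using 2
    simp only [Pi.add_apply, Pi.smul_apply, smul_eq_mul]
    ring
  · have e : ∀ i, (t + β • u + (γ + 2 * q) • v) i = t i + β * u i + γ * v i + 2 * (q * v i) := by
      intro i
      simp only [Pi.add_apply, Pi.smul_apply, smul_eq_mul]
      ring
    rw [e, e, e]
    omega
  · have : tripleDet u v (t + β • u + (γ + 2 * q) • v) = tripleDet u v t := by
      simp only [tripleDet, Pi.add_apply, Pi.smul_apply, smul_eq_mul]
      ring
    rwa [this]

end PalindromicComplex

theorem mainTheorem9 :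
    SimplyConnectedSpace PalindromicComplex.augmentedComplex.Realization := by
  -- The apex $e_3$ has height 1; the criterion does not require the apex to lie at height 0.
  refine PreAbstractSimplicialComplex.simplyConnectedSpace_of_height _ (fun v => (v 2).natAbs)
    (b := ![0, 0, 1]) ?_ (fun _ _ => PalindromicComplex.cone_mem)
    (fun _ => PalindromicComplex.descending_link)
    (fun _ _ => PalindromicComplex.exists_lower_of_horizontal)
  exact PreAbstractSimplicialComplex.left_mem_faces
    (PalindromicComplex.pair_mem_augmentedComplex (y := ![1, 0, 0]) (z := ![0, 1, 0])
      PalindromicComplex.admissible_e₃ (by simp [PalindromicComplex.Admissible])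
      (by simp [PalindromicComplex.tripleDet]))
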